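/- Let $X$ be an arbitrary metric space (not assumed proper) and let $A,B\subseteq X$ be subsets with $X=A\cup B$, each regarded as a metric space with the restricted metric. Then $$\operatorname{asdim}(X)=\max\bigl(\operatorname{asdim}(A),\operatorname{asdim}(B)\bigr)$$ as an equality in $\{0,1,2,\dots\}\cup\{\infty\}$. Here the asymptotic dimension is defined as follows. For a family $\mathcal U$ of subsets of a metric space $Y$, the Lebesgue number of $\mathcal U$ is $$L(\mathcal U,Y)=\inf_{x\in Y}\ \sup_{U\in\mathcal U}\operatorname{dist}(x,Y\setminus U)\in[0,\infty],\qquad \operatorname{dist}(x,\emptyset)=\infty,$$ and the multiplicity of $\mathcal U$ is the supremum over $x\in Y$ of the number of elements of $\mathcal U$ containing $x$. A family $\mathcal V$ refines $\mathcal U$ if every element of $\mathcal V$ is contained in some element of $\mathcal U$. For an integer $n\ge 0$, $L^n(\mathcal U,Y)$ is the supremum of all $t\in[0,\infty]$ such that $\mathcal U$ has a refinement of multiplicity at most $n+1$ and Lebesgue number at least $t$. Then $\operatorname{asdim}(Y)$ is the smallest integer $n\ge 0$ such that $L^n(\mathcal U_k,Y)\to\infty$ for every sequence $(\mathcal U_k)$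 of covers of $Y$ with $L(\mathcal U_k,Y)\to\infty$, and $\operatorname{asdim}(Y)=\infty$ if there is no such $n$. -/

import Mathlib

open Filter Topology
open scoped ENNReal

namespace CoarseDim

/-- A family of sets is a cover of the whole space. -/
def IsCover {X : Type*} (𝒰 : Set (Set X)) : Prop := ⋃₀ 𝒰 = Set.univ

/-- `𝒱` refines `𝒰`: every element of `𝒱` is contained in an element of `𝒰`. -/
def Refines {X : Type*} (𝒱 𝒰 : Set (Set X)) : Prop := ∀ V ∈ 𝒱, ∃ U ∈ 𝒰, V ⊆ U

/-- The multiplicity of a family: the supremum over all points `x` of the number of elements of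
the family that contain `x`. -/
noncomputable def multiplicity {X : Type*} (𝒰 : Set (Set X)) : ℕ∞ :=
  ⨆ x : X, {U | U ∈ 𝒰 ∧ x ∈ U}.encard

/-- The local Lebesgue number of a family at `x`: the supremum over `U ∈ 𝒰` of the distance from
`x` to the complement of `U`. The distance to the empty set is `∞`, so the value is `∞` when the
whole space belongs to `𝒰`. -/
noncomputable def localLebesgueNumber {X : Type*} [PseudoMetricSpace X] (𝒰 : Set (Set X))
    (x : X) : ℝ≥0∞ :=
  ⨆ U ∈ 𝒰, Metric.infEDist x Uᶜ

/-- The Lebesgue number `L(𝒰, X)` of a family in `X`. -/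
noncomputable def lebesgueNumber {X : Type*} [PseudoMetricSpace X] (𝒰 : Set (Set X)) : ℝ≥0∞ :=
  ⨅ x : X, localLebesgueNumber 𝒰 x

/-- The `n`-th Lebesgue number `L^n(𝒰, X)`: the supremum of all `t ∈ [0, ∞]` such that `𝒰` has a
refinement of multiplicity at most `n + 1` and Lebesgue number at least `t`. -/
noncomputable def higherLebesgueNumber {X : Type*} [PseudoMetricSpace X] (n : ℕ)
    (𝒰 : Set (Set X)) : ℝ≥0∞ :=
  sSup {t : ℝ≥0∞ | ∃ 𝒱 : Set (Set X),
    Refines 𝒱 𝒰 ∧ multiplicity 𝒱 ≤ (n : ℕ∞) + 1 ∧ t ≤ lebesgueNumber 𝒱}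

/-- A `[0, ∞]`-valued function on families is coarsely proper on the space of all covers of `X`
if `f (𝒰 k) → ∞` for every sequence of covers with `𝒰 k → ∞`, where the latter
means that the Lebesgue numbers of the covers tend to `∞`. -/
def CoarselyProperOnCovers {X : Type*} [PseudoMetricSpace X] (f : Set (Set X) → ℝ≥0∞) : Prop :=
  ∀ 𝒰 : ℕ → Set (Set X), (∀ k, IsCover (𝒰 k)) →
    Tendsto (fun k => lebesgueNumber (𝒰 k)) atTop (𝓝 ∞) →
    Tendsto (fun k => f (𝒰 k)) atTop (𝓝 ∞)

/-- The asymptotic dimension of `X`: the smallest integer `n ≥ 0` such that `𝒰 ↦ L^n(𝒰, X)` is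
coarsely proper on the space of all covers of `X`, and `∞` if there is none. -/
noncomputable def asdim (X : Type*) [PseudoMetricSpace X] : ℕ∞ :=
  sInf {m : ℕ∞ | ∃ n : ℕ, m = (n : ℕ∞) ∧
    CoarselyProperOnCovers (fun 𝒰 : Set (Set X) => higherLebesgueNumber n 𝒰)}

end CoarseDim

namespace CoarseDim

-- The bound `asdim Y ≤ n` is equivalent to `Colorable n Y`, which visibly passes to subspaces and
-- to larger `n`. For a union, colour `B` at a scale far beyond the piece size of `A`: each piece of
-- `A` is then close to at most one piece of `B` of its colour and can be absorbed into it. For the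
-- equivalence, a bounded cover of multiplicity at most `n + 1` gives a colouring by looking, at
-- each point, for a gap in the sorted depths of the point in the cover's members; the number of
-- members above the gap is the colour. Conversely, thickened pieces of a colouring form the
-- required refinement.

universe u

/-! ### Colourings of subspaces and unions -/

/-- For every scale `r`, the space can be coloured with `n + 1` colours so that each colour class
splits into uniformly bounded pieces (the fibres of a labelling) that are `r`-disjoint. -/
def Colorable (n : ℕ) (Y : Type u) [PseudoMetricSpace Y] : Prop :=
  ∀ r : ℝ, ∃ (D : ℝ) (T : Type u) (c : Y → Fin (n + 1)) (l : Y → T),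
    (∀ x y, c x = c y → dist x y < r → l x = l y) ∧
    (∀ x y, c x = c y → l x = l y → dist x y ≤ D)

theorem Colorable.mono {m n : ℕ} (h : m ≤ n) {Y : Type u} [PseudoMetricSpace Y]
    (hY : Colorable m Y) : Colorable n Y := by
  intro r
  obtain ⟨D, T, c, l, h1, h2⟩ := hY r
  refine ⟨D, T, fun x => Fin.castLE (by omega) (c x), l, fun x y hc => h1 x y ?_,
    fun x y hc => h2 x y ?_⟩
  · exact Fin.castLE_injective _ hc
  · exact Fin.castLE_injective _ hc

theorem Colorable.subtype {n : ℕ} {Y : Type u} [PseudoMetricSpace Y]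
    (hY : Colorable n Y) (A : Set Y) : Colorable n A := by
  intro r
  obtain ⟨D, T, c, l, h1, h2⟩ := hY r
  exact ⟨D, T, fun x => c x, fun x => l x, fun x y => h1 x y, fun x y => h2 x y⟩

/-- The saturated union of a colouring of `A` and a much coarser colouring of `B`. -/
theorem Colorable.union {n : ℕ} {X : Type u} [PseudoMetricSpace X] {A B : Set X}
    (hAB : A ∪ B = Set.univ) (hA : Colorable n A) (hB : Colorable n B) : Colorable n X := by
  classical
  intro r
  obtain ⟨D, T, c, l, c1, c2⟩ := hA r
  -- Points of `B` within `r` of one `A`-piece are less than `D + 2 * r` apart, so equally coloured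
  -- ones share a label.
  obtain ⟨E, S, d, m, d1, d2⟩ := hB (max r (D + 2 * r))
  have memA : ∀ x, x ∉ B → x ∈ A := fun x hx =>
    (show x ∈ A ∪ B by rw [hAB]; trivial).resolve_right hx
  let near : Fin (n + 1) → T → B → Prop := fun i t b =>
    d b = i ∧ ∃ y : A, c y = i ∧ l y = t ∧ dist (y : X) b < r
  have near_eq : ∀ i t b b', near i t b → near i t b' → m b = m b' := by
    rintro i t b b' ⟨hb, y, hy, hyt, hyb⟩ ⟨hb', y', hy', hyt', hyb'⟩
    refine d1 b b' (hb.trans hb'.symm) (lt_max_of_lt_right ?_)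
    have h1 : dist (y : X) y' ≤ D := c2 y y' (hy.trans hy'.symm) (hyt.trans hyt'.symm)
    have h2 := dist_triangle4 (b : X) y y' b'
    rw [dist_comm (b : X) y] at h2
    change dist (b : X) b' < _
    linarith
  let col : X → Fin (n + 1) := fun x => if h : x ∈ B then d ⟨x, h⟩ else c ⟨x, memA x h⟩
  -- An `A`-piece takes the label of the `B`-piece near it, if any, and otherwise keeps its own.
  let g : Fin (n + 1) → T → S ⊕ T := fun i t =>
    if h : ∃ b, near i t b then Sum.inl (m h.choose) else Sum.inr t
  let lab : X → S ⊕ T := fun x =>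
    if h : x ∈ B then Sum.inl (m ⟨x, h⟩) else g (c ⟨x, memA x h⟩) (l ⟨x, memA x h⟩)
  have g_near : ∀ i t b, near i t b → g i t = Sum.inl (m b) := by
    intro i t b hb
    have h : ∃ b, near i t b := ⟨b, hb⟩
    simp only [g, dif_pos h]
    rw [near_eq i t _ b h.choose_spec hb]
  have mixed : ∀ x y, x ∈ B → y ∉ B → col x = col y → dist x y < r → lab x = lab y := by
    intro x y hx hy hc hd
    simp only [col, dif_pos hx, dif_neg hy] at hc
    simp only [lab, dif_pos hx, dif_neg hy]
    exact (g_near _ _ ⟨x, hx⟩ ⟨hc, ⟨y, memA y hy⟩, rfl, rfl, by rwa [dist_comm]⟩).symm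
  -- A merged piece lies within `|D| + |r|` of its `B`-piece. Absolute values are needed since `D`,
  -- `E`, `r` may be negative.
  refine ⟨max (|E| + 2 * (|D| + |r|)) D, S ⊕ T, col, lab, ?_, ?_⟩
  · intro x y hc hd
    by_cases hx : x ∈ B <;> by_cases hy : y ∈ B
    · simp only [col, dif_pos hx, dif_pos hy] at hc
      simp only [lab, dif_pos hx, dif_pos hy]
      exact congrArg _ (d1 ⟨x, hx⟩ ⟨y, hy⟩ hc (lt_max_of_lt_left hd))
    · exact mixed x y hx hy hc hd
    · exact (mixed y x hy hx hc.symm (by rwa [dist_comm])).symm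
    · simp only [col, dif_neg hx, dif_neg hy] at hc
      simp only [lab, dif_neg hx, dif_neg hy]
      rw [hc, c1 ⟨x, memA x hx⟩ ⟨y, memA y hy⟩ hc hd]
  · have key : ∀ x s, lab x = Sum.inl s →
        ∃ b : B, d b = col x ∧ m b = s ∧ dist x b ≤ |D| + |r| := by
      intro x s hs
      by_cases hx : x ∈ B
      · simp only [lab, dif_pos hx, Sum.inl.injEq] at hs
        exact ⟨⟨x, hx⟩, by simp only [col, dif_pos hx], hs, by simp; positivity⟩
      · simp only [lab, dif_neg hx, g] at hs
        split_ifs at hs with h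
        obtain ⟨hdb, y, hy, hyl, hyb⟩ := h.choose_spec
        refine ⟨h.choose, by simp only [col, dif_neg hx]; exact hdb, Sum.inl.inj hs, ?_⟩
        have h1 : dist x y ≤ D := c2 ⟨x, memA x hx⟩ y hy.symm hyl.symm
        linarith [dist_triangle x y h.choose, le_abs_self D, le_abs_self r]
    intro x y hc hl
    rcases hs : lab x with s | t
    · obtain ⟨b, hb, hbm, hxb⟩ := key x s hs
      obtain ⟨b', hb', hbm', hyb'⟩ := key y s (hl.symm.trans hs)
      have h1 : dist (b : X) b' ≤ E :=
        d2 b b' (hb.trans (hc.trans hb'.symm)) (hbm.trans hbm'.symm)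
      have h2 := dist_triangle4 x b b' y
      rw [dist_comm (b' : X) y] at h2
      exact le_max_of_le_left (by linarith [le_abs_self E])
    · have out : ∀ z, lab z = Sum.inr t → ∃ h : z ∉ B, l ⟨z, memA z h⟩ = t := by
        intro z hz
        by_cases hzB : z ∈ B
        · simp [lab, dif_pos hzB] at hz
        · refine ⟨hzB, ?_⟩
          simp only [lab, dif_neg hzB, g] at hz
          split_ifs at hz with h
          exact Sum.inr.inj hz
      obtain ⟨hx, hxt⟩ := out x hs
      obtain ⟨hy, hyt⟩ := out y (hl.symm.trans hs)
      simp only [col, dif_neg hx, dif_neg hy] at hc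
      exact le_max_of_le_right (c2 ⟨x, memA x hx⟩ ⟨y, memA y hy⟩ hc (hxt.trans hyt.symm))

/-! ### From covers to colourings -/

/-- Among finitely many reals, one of which is large compared to their number, the values above
some level are separated by a gap from the remaining ones. -/
theorem exists_finset_gap {α : Type*} [DecidableEq α] (f : α → ℝ) {ε : ℝ} (hε : 0 < ε) (m : ℕ) :
    ∀ (t : ℝ) (S : Finset α), S.card ≤ m → (∃ s ∈ S, t + m * ε ≤ f s) →
      ∃ F ⊆ S, F.Nonempty ∧ (∀ a ∈ F, t + ε ≤ f a) ∧
        ∀ a ∈ F, ∀ b ∈ S, b ∉ F → f b + ε ≤ f a := by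
  induction m with
  | zero =>
    rintro t S hS ⟨s, hs, -⟩
    simp_all
  | succ m ih =>
    rintro t S hS ⟨s, hs, hfs⟩
    obtain ⟨a, ha, hmin⟩ := S.exists_min_image f ⟨s, hs⟩
    push_cast at hfs
    have hmε : 0 ≤ m * ε := by positivity
    by_cases hat : t + ε ≤ f a
    · exact ⟨S, subset_rfl, ⟨s, hs⟩, fun b hb => hat.trans (hmin b hb),
        fun _ _ b hb hb' => absurd hb hb'⟩
    · have hsa : s ≠ a := by
        rintro rfl
        exact hat (by linarith)
      -- Dropping the minimum raises the level by at most `ε`, which the decrease of `m` pays for.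
      obtain ⟨F, hFS, hF, h1, h2⟩ := ih (max t (f a)) (S.erase a)
        (by rw [Finset.card_erase_of_mem ha]; omega)
        ⟨s, Finset.mem_erase.2 ⟨hsa, hs⟩, by
          have : max t (f a) ≤ t + ε := max_le (by linarith) (by linarith)
          linarith⟩
      refine ⟨F, hFS.trans (Finset.erase_subset _ _), hF, fun b hb => ?_, fun b hb b' hb' hbF => ?_⟩
      · linarith [h1 b hb, le_max_left t (f a)]
      · by_cases hba : b' = a
        · subst hba
          linarith [h1 b hb, le_max_right t (f b')]
        · exact h2 b hb b' (Finset.mem_erase.2 ⟨hba, hb'⟩) hbF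

theorem le_infEDist_compl_of_ball_subset {Y : Type*} [PseudoMetricSpace Y] {x : Y} {s : ℝ}
    {U : Set Y} (h : Metric.ball x s ⊆ U) : ENNReal.ofReal s ≤ Metric.infEDist x Uᶜ := by
  refine Metric.le_infEDist.2 fun y hy => ?_
  rw [edist_dist]
  refine ENNReal.ofReal_le_ofReal ?_
  by_contra hlt
  exact hy (h (by rw [Metric.mem_ball, dist_comm]; exact not_le.1 hlt))

/-- The distance to the complement of `V`, truncated at `M`. -/
noncomputable def depth {Y : Type*} [PseudoMetricSpace Y] (M : ℝ) (V : Set Y) (x : Y) : ℝ :=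
  -- Truncation keeps the value meaningful for `V = univ`, where the distance is `∞`.
  (min (Metric.infEDist x Vᶜ) (ENNReal.ofReal M)).toReal

theorem depth_le_add_dist {Y : Type*} [PseudoMetricSpace Y] (M : ℝ) (V : Set Y) (x y : Y) :
    depth M V x ≤ depth M V y + dist x y := by
  have hfin : min (Metric.infEDist y Vᶜ) (ENNReal.ofReal M) ≠ ∞ :=
    ne_top_of_le_ne_top ENNReal.ofReal_ne_top (min_le_right _ _)
  unfold depth
  rw [dist_edist, ← ENNReal.toReal_add hfin (edist_ne_top _ _)]
  refine ENNReal.toReal_mono (ENNReal.add_ne_top.2 ⟨hfin, edist_ne_top _ _⟩) ?_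
  rw [min_add]
  exact min_le_min Metric.infEDist_le_infEDist_add_edist le_self_add

theorem depth_of_notMem {Y : Type*} [PseudoMetricSpace Y] (M : ℝ) {V : Set Y} {x : Y}
    (hx : x ∉ V) : depth M V x = 0 := by
  simp [depth, Metric.infEDist_zero_of_mem (show x ∈ Vᶜ from hx)]

theorem depth_eq {Y : Type*} [PseudoMetricSpace Y] {M : ℝ} (hM : 0 ≤ M) {V : Set Y} {x : Y}
    (hx : ENNReal.ofReal M ≤ Metric.infEDist x Vᶜ) : depth M V x = M := by
  rw [depth, min_eq_right hx, ENNReal.toReal_ofReal hM]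

/-- A cover of small multiplicity and large Lebesgue number subordinate to a uniformly bounded
family yields a colouring. -/
theorem exists_coloring_of_multiplicity_le {n : ℕ} {Y : Type u} [PseudoMetricSpace Y]
    {𝒱 : Set (Set Y)} {r D : ℝ} (hr : 0 < r) (hm : multiplicity 𝒱 ≤ (n : ℕ∞) + 1)
    (hL : ENNReal.ofReal ((n + 1) * r) < lebesgueNumber 𝒱)
    (hD : ∀ V ∈ 𝒱, ∀ x ∈ V, ∀ y ∈ V, dist x y ≤ D) :
    ∃ (c : Y → Fin (n + 1)) (l : Y → Finset (Set Y)),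
      (∀ x y, c x = c y → dist x y < r → l x = l y) ∧
      (∀ x y, c x = c y → l x = l y → dist x y ≤ D) := by
  classical
  set M : ℝ := (n + 1) * r with hM
  have hM0 : 0 ≤ M := by positivity
  have main : ∀ x, ∃ F : Finset (Set Y), F.Nonempty ∧ F.card ≤ n + 1 ∧ (∀ V ∈ F, V ∈ 𝒱 ∧ x ∈ V) ∧
      ∀ V ∈ F, ∀ W ∈ 𝒱, W ∉ F → depth M W x + r ≤ depth M V x := by
    intro x
    have hcard : {U | U ∈ 𝒱 ∧ x ∈ U}.encard ≤ ((n + 1 : ℕ) : ℕ∞) := by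
      push_cast
      exact (le_iSup (fun x => {U | U ∈ 𝒱 ∧ x ∈ U}.encard) x).trans hm
    have hfin : {U | U ∈ 𝒱 ∧ x ∈ U}.Finite := Set.finite_of_encard_le_coe hcard
    have hmem : ∀ V, V ∈ hfin.toFinset ↔ V ∈ 𝒱 ∧ x ∈ V := fun V => by simp
    have hcard' : hfin.toFinset.card ≤ n + 1 := by
      rw [hfin.encard_eq_coe_toFinset_card] at hcard
      exact_mod_cast hcard
    obtain ⟨V, hV, hVx⟩ : ∃ V ∈ 𝒱, ENNReal.ofReal M < Metric.infEDist x Vᶜ := by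
      have := hL.trans_le (iInf_le _ x)
      simpa [localLebesgueNumber, lt_iSup_iff] using this
    have hxV : x ∈ V := by
      by_contra h
      rw [Metric.infEDist_zero_of_mem (show x ∈ Vᶜ from h)] at hVx
      exact not_lt_zero hVx
    obtain ⟨F, hFS, hF, h1, h2⟩ := exists_finset_gap (fun V => depth M V x) hr (n + 1) 0
      hfin.toFinset hcard' ⟨V, (hmem V).2 ⟨hV, hxV⟩, by
        rw [depth_eq hM0 hVx.le, hM]
        push_cast
        linarith⟩
    refine ⟨F, hF, (Finset.card_le_card hFS).trans hcard', fun V hV => (hmem V).1 (hFS hV),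
      fun V hV W hW hWF => ?_⟩
    by_cases hxW : x ∈ W
    · exact h2 V hV W ((hmem W).2 ⟨hW, hxW⟩) hWF
    · rw [depth_of_notMem M hxW]
      exact h1 V hV
  choose F hne hcard hmem hgap using main
  refine ⟨fun x => ⟨(F x).card - 1, by have := hcard x; omega⟩, F, ?_, ?_⟩
  · intro x y hc hd
    have hxy : (F x).card = (F y).card := by
      have h1 := (hne x).card_pos
      have h2 := (hne y).card_pos
      have h3 := congrArg Fin.val hc
      simp only at h3
      omega
    by_contra hFxy
    obtain ⟨V, hVx, hVy⟩ := Finset.not_subset.1 fun h =>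
      hFxy (Finset.eq_of_subset_of_card_le h hxy.ge)
    obtain ⟨W, hWy, hWx⟩ := Finset.not_subset.1 fun h =>
      hFxy (Finset.eq_of_subset_of_card_le h hxy.le).symm
    -- The depths of `V` and `W` are ordered oppositely at `x` and `y`, each with gap `r`; as depth
    -- is 1-Lipschitz, `2 * r ≤ 2 * dist x y`.
    have h1 := hgap x V hVx W (hmem y W hWy).1 hWx
    have h2 := hgap y W hWy V (hmem x V hVx).1 hVy
    have h3 := depth_le_add_dist M V x y
    have h4 := depth_le_add_dist M W y x
    rw [dist_comm y x] at h4
    linarith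
  · intro x y _ hl
    obtain ⟨V, hV⟩ := hne x
    exact hD V (hmem x V hV).1 x (hmem x V hV).2 y (hmem y V (hl ▸ hV)).2

theorem Colorable.of_coarselyProper {n : ℕ} {Y : Type u} [PseudoMetricSpace Y]
    (h : CoarselyProperOnCovers (fun 𝒰 : Set (Set Y) => higherLebesgueNumber n 𝒰)) :
    Colorable n Y := by
  intro r
  -- Refining a cover by balls forces bounded members; the `+ 1` makes `k = 0` a cover too.
  let 𝒰 : ℕ → Set (Set Y) := fun k => Set.range fun x : Y => Metric.ball x (k + 1)
  have hcov : ∀ k, IsCover (𝒰 k) := fun k => Set.eq_univ_of_forall fun x =>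
    ⟨_, ⟨x, rfl⟩, Metric.mem_ball_self (by positivity)⟩
  have hL : ∀ k : ℕ, (k : ℝ≥0∞) ≤ lebesgueNumber (𝒰 k) := by
    intro k
    refine le_iInf fun x => ?_
    have h1 : (k : ℝ≥0∞) ≤ ENNReal.ofReal (k + 1) := by
      rw [← ENNReal.ofReal_natCast]
      exact ENNReal.ofReal_le_ofReal (by linarith)
    exact h1.trans ((le_infEDist_compl_of_ball_subset subset_rfl).trans
      (le_iSup₂_of_le (Metric.ball x (k + 1)) ⟨x, rfl⟩ le_rfl))
  have htend := h 𝒰 hcov (tendsto_nhds_top_mono' ENNReal.tendsto_nat_nhds_top hL)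
  obtain ⟨k, hk⟩ := (htend.eventually (lt_mem_nhds
    (ENNReal.ofReal_lt_top (r := (n + 1) * max r 1)))).exists
  obtain ⟨t, ⟨𝒱, href, hmul, ht⟩, hlt⟩ := lt_sSup_iff.1 hk
  obtain ⟨c, l, h1, h2⟩ := exists_coloring_of_multiplicity_le (D := 2 * (k + 1))
    (lt_max_of_lt_right one_pos) hmul (hlt.trans_le ht) (by
      intro V hV x hx y hy
      obtain ⟨_, ⟨z, rfl⟩, hVz⟩ := href V hV
      have hxz := Metric.mem_ball.1 (hVz hx)
      have hyz := Metric.mem_ball.1 (hVz hy)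
      linarith [dist_triangle_right x y z])
  exact ⟨_, _, c, l, fun x y hc hd => h1 x y hc (lt_max_of_lt_left hd), h2⟩

/-! ### From colourings to covers -/

theorem Colorable.coarselyProper {n : ℕ} {Y : Type u} [PseudoMetricSpace Y]
    (hY : Colorable n Y) :
    CoarselyProperOnCovers (fun 𝒰 : Set (Set Y) => higherLebesgueNumber n 𝒰) := by
  intro 𝒰 _ htend
  rw [ENNReal.tendsto_nhds_top_iff_nnreal]
  intro r
  set s : ℝ := r + 1 with hs
  have hs0 : 0 < s := by positivity
  -- At scale `2 * s`, a point lies in the `s`-neighbourhood of at most one piece of each colour.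
  obtain ⟨D, T, c, l, h1, h2⟩ := hY (2 * s)
  filter_upwards [htend.eventually (lt_mem_nhds (ENNReal.ofReal_lt_top (r := D + s)))] with k hk
  let N : Y → Set Y := fun x => {y | ∃ z, c z = c x ∧ l z = l x ∧ dist y z < s}
  have hrs : (r : ℝ≥0∞) < ENNReal.ofReal s := by
    rw [← ENNReal.ofReal_coe_nnreal]
    exact (ENNReal.ofReal_lt_ofReal_iff hs0).2 (by linarith)
  refine hrs.trans_le (le_sSup ⟨Set.range N, ?_, ?_, ?_⟩)
  · rintro _ ⟨x, rfl⟩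
    obtain ⟨U, hU, hUx⟩ : ∃ U ∈ 𝒰 k, ENNReal.ofReal (D + s) < Metric.infEDist x Uᶜ := by
      have := hk.trans_le (iInf_le _ x)
      simpa [localLebesgueNumber, lt_iSup_iff] using this
    refine ⟨U, hU, ?_⟩
    rintro y ⟨z, hzc, hzl, hyz⟩
    by_contra hyU
    have h3 := hUx.trans_le (Metric.infEDist_le_edist_of_mem (show y ∈ Uᶜ from hyU))
    rw [edist_dist] at h3
    have h4 := (ENNReal.ofReal_lt_ofReal_iff'.1 h3).1
    have h5 := h2 z x hzc hzl
    linarith [dist_triangle_left x y z, dist_comm y z]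
  · refine iSup_le fun y => ?_
    have hcard : (Set.univ : Set (Fin (n + 1))).encard = (n : ℕ∞) + 1 := by
      simp [Set.encard_univ]
    rw [← hcard]
    have hsub : ∀ U ∈ {U | U ∈ Set.range N ∧ y ∈ U}, ∃ i, ∃ x, c x = i ∧ N x = U := by
      rintro U ⟨⟨x, rfl⟩, -⟩
      exact ⟨_, x, rfl, rfl⟩
    have : Nonempty Y := ⟨y⟩
    choose! i x hx hN using hsub
    -- Colour is injective on the neighbourhoods containing `y`, so there are at most `n + 1`.
    refine Set.encard_le_encard_of_injOn (f := i) (fun _ _ => Set.mem_univ _) ?_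
    intro U hU U' hU' hii
    have hcx : c (x U) = c (x U') := by rw [hx U hU, hx U' hU', hii]
    have hy := hU.2
    have hy' := hU'.2
    rw [← hN U hU] at hy
    rw [← hN U' hU'] at hy'
    obtain ⟨z, hz, hzl, hyz⟩ := hy
    obtain ⟨z', hz', hzl', hyz'⟩ := hy'
    have hl : l z = l z' := h1 z z' (hz.trans (hcx.trans hz'.symm)) (by
      linarith [dist_triangle_left z z' y])
    rw [← hN U hU, ← hN U' hU']
    simp only [N, hcx, ← hzl, hl, hzl']
  · exact le_iInf fun x => le_iSup₂_of_le (N x) ⟨x, rfl⟩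
      (le_infEDist_compl_of_ball_subset fun y hy => ⟨x, rfl, rfl, hy⟩)

theorem asdim_le_iff_colorable {n : ℕ} {Y : Type u} [PseudoMetricSpace Y] :
    asdim Y ≤ n ↔ Colorable n Y := by
  constructor
  · intro h
    have hne : {m : ℕ∞ | ∃ n : ℕ, m = (n : ℕ∞) ∧ CoarselyProperOnCovers
        (fun 𝒰 : Set (Set Y) => higherLebesgueNumber n 𝒰)}.Nonempty := by
      -- Were the set empty, its infimum would be `⊤`, not at most `n`.
      by_contra hempty
      rw [asdim, Set.not_nonempty_iff_eq_empty.1 hempty, sInf_empty] at h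
      exact absurd h (by simp)
    obtain ⟨m, hm, hcp⟩ := csInf_mem hne
    have hmn : (m : ℕ∞) ≤ n := hm ▸ h
    exact (Colorable.of_coarselyProper hcp).mono (by exact_mod_cast hmn)
  · exact fun h => sInf_le ⟨n, rfl, h.coarselyProper⟩

end CoarseDim

theorem mainTheorem9 {X : Type*} [MetricSpace X] (A B : Set X) (hAB : A ∪ B = Set.univ) :
    CoarseDim.asdim X = max (CoarseDim.asdim A) (CoarseDim.asdim B) := by
  refine eq_of_forall_ge_iff fun n => ?_
  induction n using ENat.recTopCoe with
  | top => simp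
  | coe n =>
    simp only [max_le_iff, CoarseDim.asdim_le_iff_colorable]
    exact ⟨fun h => ⟨h.subtype A, h.subtype B⟩, fun h => h.1.union hAB h.2⟩
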